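/- Let $q>1$ be a prime power, let $W=\{x\in\mathbb{F}_{q^4} : x+x^q+x^{q^2}+x^{q^3}=0\}$ be the trace-zero subspace of $\mathbb{F}_{q^4}/\mathbb{F}_q$, and take $V=W\times\mathbb{F}_{q^4}$ as the $7$-dimensional $\mathbb{F}_q$-space underlying $\mathrm{PG}(6,\mathbb{F}_q)$. Let $S=\{0\}\times\mathbb{F}_{q^4}$ be the special solid. A point, respectively a plane, is a $1$-dimensional, respectively $3$-dimensional, $\mathbb{F}_q$-subspace of $V$. A plane subspace code with $t=2$ is a set $\mathcal{C}$ of planes such that $2$ is the smallest positive integer $s$ for which every $s$-dimensional subspace of $V$ is contained in at most one member of $\mathcal{C}$. For an $\mathbb{F}_q$-linear map $f\colon W\to\mathbb{F}_{q^4}$ put $\Gamma_f=\{(x,f(x)) : x\in W\}$. The lifted Gabidulin code is $\mathcal{L}=\{\Gamma_f : f(x)=a_0x+a_1x^q,\ a_0,a_1\in\mathbb{F}_{q^4}\}$. Let $\Sigma\le\mathrm{GL}(V/\mathbb{F}_q)$ be the group of all maps $(x,y)\mapsto(x,ry)$ with $r\in\mathbb{F}_{q^4}^\times$. **Theorem.**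 Let $\mathcal{L}_0$ be obtained from $\mathcal{L}$ by removing all planes $\Gamma_f$ with $f(x)=r(ux^q-u^qx)$, $r\in\mathbb{F}_{q^4}^\times$, $u\in\mathbb{F}_{q^4}\setminus W$. Then $\mathcal{L}_0$ is a plane subspace code with $t=2$ of size $\#\mathcal{L}_0=q^8-q^7+q^3$. Moreover, there is a set $\mathcal{N}'$ of planes not in $\mathcal{L}$ such that: 1. every plane in $\mathcal{N}'$ meets $S$ in exactly a point; 2. $\#\mathcal{N}'=(q^4-1)(q^3+q+1)$, and for every point $P$ on $S$ exactly $(q-1)(q^3+q+1)$ planes of $\mathcal{N}'$ pass through $P$; 3. $\mathcal{C}=\mathcal{L}_0\cup\mathcal{N}'$ is a plane subspace code with $t=2$ of size $\#\mathcal{C}=q^8+q^5+q^4-q-1$; 4. $\mathcal{C}$ is invariant under $\Sigma$. -/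

import Mathlib

open Module

namespace PlaneCode

section Codes

variable {K V : Type*} [Field K] [AddCommGroup V] [Module K V]

/-- `IsPlaneSubspaceCode t C`: the members of `C` are planes of `PG(V/K)` (that is,
3-dimensional subspaces of `V`), and `t` is the smallest positive integer such that every
`t`-dimensional subspace of `V` is contained in at most one member of `C`. -/
def IsPlaneSubspaceCode (t : ℕ) (C : Set (Submodule K V)) : Prop :=
  (∀ E ∈ C, finrank K E = 3) ∧
    IsLeast {s : ℕ | 0 < s ∧ ∀ T : Submodule K V, finrank K T = s →
      ∀ E ∈ C, ∀ E' ∈ C, T ≤ E → T ≤ E' → E = E'} t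

end Codes

section Gabidulin

variable (K L : Type*) [Field K] [Field L] [Algebra K L]

/-- The trace-zero subspace `W` of `L/K`. -/
noncomputable abbrev traceZero : Submodule K L := LinearMap.ker (Algebra.trace K L)

/-- The ambient space `V = W × L`; it is 7-dimensional over `K` when `[L : K] = 4`. -/
noncomputable abbrev Ambient : Type _ := traceZero K L × L

/-- The special solid `S = {0} × L`. -/
noncomputable def specialSolid : Submodule K (Ambient K L) := Submodule.prod ⊥ ⊤

variable {L}

/-- The element `(x, y) ↦ (x, r y)` of the group `Σ`, for `r ∈ Lˣ`. -/
noncomputable def sigmaEquiv (r : Lˣ) : Ambient K L ≃ₗ[K] Ambient K L :=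
  (LinearEquiv.refl K (traceZero K L)).prodCongr (DistribMulAction.toLinearEquiv K L r)

theorem sigmaEquiv_apply (r : Lˣ) (v : Ambient K L) :
    sigmaEquiv K r v = (v.1, (r : L) * v.2) := rfl

/-- `C` is invariant under every element of the group `Σ`. -/
def IsSigmaInvariant (C : Set (Submodule K (Ambient K L))) : Prop :=
  ∀ r : Lˣ, (fun E : Submodule K (Ambient K L) =>
    E.map (sigmaEquiv K r : Ambient K L →ₗ[K] Ambient K L)) '' C = C

variable [Fintype K]

/-- The `K`-linear map `W → L`, `x ↦ a₀ x + a₁ x ^ q`, where `q = #K`. -/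
noncomputable def gabidulinMap (a₀ a₁ : L) : traceZero K L →ₗ[K] L :=
  (LinearMap.mulLeft K a₀ +
    LinearMap.mulLeft K a₁ ∘ₗ (FiniteField.frobeniusAlgHom K L).toLinearMap) ∘ₗ
      (traceZero K L).subtype

theorem gabidulinMap_apply (a₀ a₁ : L) (x : traceZero K L) :
    gabidulinMap K a₀ a₁ x = a₀ * (x : L) + a₁ * (x : L) ^ Fintype.card K := by
  simp [gabidulinMap]

/-- The restriction to `W` of the binomial `x ↦ r (u x ^ q - u ^ q x)`. -/
noncomputable def binomialMap (r u : L) : traceZero K L →ₗ[K] L :=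
  gabidulinMap K (-(r * u ^ Fintype.card K)) (r * u)

theorem binomialMap_apply (r u : L) (x : traceZero K L) :
    binomialMap K r u x =
      r * (u * (x : L) ^ Fintype.card K - u ^ Fintype.card K * (x : L)) := by
  rw [binomialMap, gabidulinMap_apply]; ring

variable (L)

/-- The lifted Gabidulin code: the graphs `Γ_f = {(x, f x) | x ∈ W}` of all the maps
`f(x) = a₀ x + a₁ x ^ q`. -/
def liftedGabidulin : Set (Submodule K (Ambient K L)) :=
  {E | ∃ a₀ a₁ : L, E = (gabidulinMap K a₀ a₁).graph}

/-- The removed planes: the graphs of the binomials `r (u x ^ q - u ^ q x)` with `r ≠ 0` and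
`u ∉ W`. -/
def removedPlanes : Set (Submodule K (Ambient K L)) :=
  {E | ∃ r u : L, r ≠ 0 ∧ u ∉ traceZero K L ∧ E = (binomialMap K r u).graph}

/-- The expurgated code. -/
def expurgatedCode : Set (Submodule K (Ambient K L)) :=
  liftedGabidulin K L \ removedPlanes K L

end Gabidulin

end PlaneCode

/-! Write D(a, b) = a b^q - a^q b. It is nonzero when a, b are independent over K, so by Cramer's
rule a map a₀x + a₁x^q is determined by its values at a and b. Hence two planes of the lifted
Gabidulin code share no line.

The new planes are E = {(x, y) : x ∈ Z, (ρy)^q - ρy = s x^q}, with Z a line of W and ρ, s nonzero.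
Such an E meets S in the point Kρ⁻¹. If Tr(s x^q) = 0 on Z, additive Hilbert 90
(`exists_frob_sub_eq`) makes it a plane over Z. The crux is that for (a, α/ρ), (b, β/ρ) in E the
element u = aβ - bα satisfies u^q = a^q β - b^q α. This has two consequences. The Gabidulin map
through these two points is r(u x^q - u^q x) with r = 1/(ρD). Its plane has been removed as soon as
u ∉ W, which a 3 × 3 Moore determinant guarantees when s^q D^(q²) ≠ -sD (`mem_removedPlanes_of_le`).
A line of E determines (ρ, s) up to a common factor in Kˣ (`exists_smul_of_le_augmentPlane`). So new
planes never clash if one Z is fixed for each class of s modulo Kˣ.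

For s ∉ K the trace condition forces Z, and s^(1+q²) ∉ K suffices for the inequality. For s ∈ Kˣ the
trace condition is void, and any Z with D^(q²) ≠ -D serves. This leaves (q - 1)(q³ + q + 1)
parameters s, which gives the sizes. -/

namespace PlaneCode

/-- The Frobenius automorphism `x ↦ x ^ #K` of an extension of a finite field. -/
noncomputable def frob (K L : Type*) [Field K] [Fintype K] [Field L] [Algebra K L] :
    L →ₐ[K] L := FiniteField.frobeniusAlgHom K L

theorem finiteDimensional_of_finrank_eq_four {K L : Type*} [Field K] [Field L] [Algebra K L]
    (hKL : finrank K L = 4) : FiniteDimensional K L :=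
  FiniteDimensional.of_finrank_pos (by omega)

/-! ### Frobenius, trace and additive Hilbert 90 in degree four. -/

section Frobenius

variable {K L : Type*} [Field K] [Fintype K] [Field L] [Algebra K L]

theorem frob_apply (x : L) : frob K L x = x ^ Fintype.card K := rfl

theorem frob_ne_zero {x : L} (hx : x ≠ 0) : frob K L x ≠ 0 :=
  (map_ne_zero (frob K L)).2 hx

variable (hKL : finrank K L = 4)
include hKL

theorem finite_of_finrank_eq_four : Finite L :=
  have := finiteDimensional_of_finrank_eq_four hKL
  Module.finite_of_finite K

theorem natCard_of_finrank_eq_four : Nat.card L = Fintype.card K ^ 4 := by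
  have := finite_of_finrank_eq_four hKL
  have := Fintype.ofFinite L
  rw [Nat.card_eq_fintype_card, Module.card_eq_pow_finrank (K := K), hKL]

theorem frob_frob_frob_frob (x : L) : frob K L (frob K L (frob K L (frob K L x))) = x := by
  have := finite_of_finrank_eq_four hKL
  have := Fintype.ofFinite L
  have h := FiniteField.pow_card x
  rw [← Nat.card_eq_fintype_card, natCard_of_finrank_eq_four hKL] at h
  simp only [frob_apply, ← pow_mul]
  convert h using 2
  ring

theorem trace_eq_sum_frob (x : L) :
    algebraMap K L (Algebra.trace K L x) =
      x + frob K L x + frob K L (frob K L x) + frob K L (frob K L (frob K L x)) := by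
  have := finite_of_finrank_eq_four hKL
  rw [FiniteField.algebraMap_trace_eq_sum_pow, hKL]
  simp only [Finset.sum_range_succ, frob_apply, ← pow_mul, Nat.card_eq_fintype_card]
  simp [pow_succ]

theorem trace_frob (x : L) : Algebra.trace K L (frob K L x) = Algebra.trace K L x := by
  apply (algebraMap K L).injective
  rw [trace_eq_sum_frob hKL, trace_eq_sum_frob hKL, frob_frob_frob_frob hKL]
  ring

theorem frob_eq_self_iff {x : L} : frob K L x = x ↔ ∃ c : K, algebraMap K L c = x := by
  refine ⟨fun h => ?_, fun ⟨c, hc⟩ => hc ▸ (frob K L).commutes c⟩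
  have := finiteDimensional_of_finrank_eq_four hKL
  have hmem : x ∈ (Finset.univ.map ⟨algebraMap K L, (algebraMap K L).injective⟩ : Finset L) := by
    classical
    by_contra hx
    have h1 := FiniteField.X_pow_card_sub_X_ne_zero L (Fintype.one_lt_card (α := K))
    have h2 := FiniteField.X_pow_card_sub_X_natDegree_eq L (Fintype.one_lt_card (α := K))
    have h3 : insert x (Finset.univ.map ⟨algebraMap K L, (algebraMap K L).injective⟩) ⊆
        (Polynomial.X ^ Fintype.card K - Polynomial.X : Polynomial L).roots.toFinset := by
      intro y hy
      rw [Multiset.mem_toFinset, Polynomial.mem_roots h1]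
      rcases Finset.mem_insert.1 hy with rfl | hy
      · simpa [sub_eq_zero, frob_apply] using h
      · obtain ⟨c, -, rfl⟩ := Finset.mem_map.1 hy
        simp [← map_pow, FiniteField.pow_card]
    have h4 := (Finset.card_le_card h3).trans
      ((Multiset.toFinset_card_le _).trans (Polynomial.card_roots' _))
    rw [Finset.card_insert_of_notMem hx, h2] at h4
    simp at h4
  simpa using hmem

theorem mem_traceZero_iff {x : L} : x ∈ traceZero K L ↔
    frob K L (frob K L (frob K L x)) = -(x + frob K L x + frob K L (frob K L x)) := by
  rw [LinearMap.mem_ker, ← (algebraMap K L).injective.eq_iff, trace_eq_sum_frob hKL, map_zero,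
    add_comm, add_eq_zero_iff_eq_neg]

theorem finrank_traceZero : finrank K (traceZero K L) = 3 := by
  have := finiteDimensional_of_finrank_eq_four hKL
  have h : finrank K (Algebra.trace K L).range + finrank K (traceZero K L) = finrank K L :=
    (Algebra.trace K L).finrank_range_add_finrank_ker
  rw [LinearMap.range_eq_top.2 (Algebra.trace_surjective K L), finrank_top, finrank_self, hKL] at h
  omega

/-- Additive Hilbert 90 by dimension: y ↦ y^q - y has kernel K and image inside W, and both the
image and W have dimension 3. -/
theorem exists_frob_sub_eq {z : L} (hz : z ∈ traceZero K L) : ∃ y, frob K L y - y = z := by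
  have := finiteDimensional_of_finrank_eq_four hKL
  set g : L →ₗ[K] L := (frob K L).toLinearMap - .id
  have hker : LinearMap.ker g = (Algebra.linearMap K L).range := by
    ext x
    simp only [g, LinearMap.mem_ker, LinearMap.sub_apply, sub_eq_zero, LinearMap.mem_range]
    exact frob_eq_self_iff hKL
  have hk : finrank K (LinearMap.ker g) = 1 := by
    rw [hker, LinearMap.finrank_range_of_inj (algebraMap K L).injective, finrank_self]
  have hr : LinearMap.range g ≤ traceZero K L := by
    rintro _ ⟨y, rfl⟩
    simp [g, trace_frob hKL]
  have h := g.finrank_range_add_finrank_ker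
  have heq := Submodule.eq_of_le_of_finrank_eq hr (by rw [finrank_traceZero hKL]; omega)
  rw [← heq] at hz
  exact hz

/-- Testing on x = z^q - z gives Tr((s^q - s) z^(q²)) = 0 for every z, and the trace form is
nondegenerate. -/
theorem frob_eq_self_of_trace_mul_frob {s : L}
    (h : ∀ x ∈ traceZero K L, Algebra.trace K L (s * frob K L x) = 0) : frob K L s = s := by
  have := finiteDimensional_of_finrank_eq_four hKL
  have h0 : ∀ y, Algebra.trace K L ((frob K L s - s) * y) = 0 := by
    intro y
    obtain ⟨z, hz⟩ : ∃ z, frob K L (frob K L z) = y :=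
      ⟨frob K L (frob K L y), frob_frob_frob_frob hKL y⟩
    have := h (frob K L z - z) (by simp [trace_frob hKL])
    rw [map_sub, mul_sub, map_sub, hz] at this
    rw [sub_mul, map_sub, ← hz, ← map_mul, trace_frob hKL, hz]
    linear_combination -this
  have hnd := (traceForm_nondegenerate K L).1 (frob K L s - s) fun y => by
    rw [Algebra.traceForm_apply, h0]
  exact sub_eq_zero.1 hnd

end Frobenius

/-! ### Moore determinants and general linear algebra. -/

section Moore

variable {K L : Type*} [Field K] [Fintype K] [Field L] [Algebra K L]

/-- The Moore determinant of two elements. -/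
noncomputable def moore (K : Type*) {L : Type*} [Field K] [Fintype K] [Field L] [Algebra K L]
    (a b : L) : L := a * frob K L b - frob K L a * b

theorem exists_smul_of_moore_eq_zero (hKL : finrank K L = 4) {a b : L} (ha : a ≠ 0)
    (h : moore K a b = 0) : ∃ c : K, b = c • a := by
  have hf : frob K L (b / a) = b / a := by
    rw [moore] at h
    rw [map_div₀, div_eq_div_iff (frob_ne_zero ha) ha]
    linear_combination h
  obtain ⟨c, hc⟩ := (frob_eq_self_iff hKL).1 hf
  refine ⟨c, ?_⟩
  rw [Algebra.smul_def, hc, div_mul_cancel₀ _ ha]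

end Moore

section LinearAlgebra

variable {K V M N : Type*} [Field K] [AddCommGroup V] [Module K V] [AddCommGroup M] [Module K M]
  [AddCommGroup N] [Module K N]

theorem finrank_eq_finrank_map_fst_add [FiniteDimensional K M] [FiniteDimensional K N]
    (E : Submodule K (M × N)) :
    finrank K E = finrank K (E.map (LinearMap.fst K M N)) +
      finrank K (E ⊓ Submodule.prod ⊥ ⊤ : Submodule K (M × N)) := by
  have h1 := ((LinearMap.fst K M N).domRestrict E).finrank_range_add_finrank_ker
  have h2 : LinearMap.ker (LinearMap.fst K M N) = Submodule.prod ⊥ ⊤ := by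
    ext v
    simp
  rw [LinearMap.range_domRestrict, LinearMap.ker_domRestrict, h2] at h1
  rw [← h1, ← Submodule.map_comap_subtype, Submodule.finrank_map_subtype_eq]

theorem exists_pair_of_finrank_eq_two {T : Submodule K V} (hT : finrank K T = 2) :
    ∃ v ∈ T, ∃ w ∈ T, ∀ c d : K, c • v + d • w = 0 → c = 0 ∧ d = 0 := by
  have := FiniteDimensional.of_finrank_pos (K := K) (V := T) (by omega)
  let b := finBasisOfFinrankEq K T hT
  have h := (Fintype.linearIndependent_iff.1 b.linearIndependent)
  refine ⟨b 0, (b 0).2, b 1, (b 1).2, fun c d hcd => ?_⟩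
  have := h ![c, d] (by simpa [Fin.sum_univ_two, Subtype.ext_iff] using hcd)
  exact ⟨this 0, this 1⟩

end LinearAlgebra

/-! ### The new planes: dimension and intersection with the special solid. -/

section Planes

variable {K L : Type*} [Field K] [Fintype K] [Field L] [Algebra K L]

/-- The plane `{(x, y) | x ∈ Z, (ρ y) ^ q - ρ y = s x ^ q}`. -/
noncomputable def augmentPlane (Z : Submodule K (traceZero K L)) (ρ s : L) :
    Submodule K (Ambient K L) :=
  Z.comap (LinearMap.fst K _ _) ⊓
    LinearMap.ker (((frob K L).toLinearMap - .id) ∘ₗ LinearMap.mulLeft K ρ ∘ₗ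
        LinearMap.snd K (traceZero K L) L -
      LinearMap.mulLeft K s ∘ₗ (frob K L).toLinearMap ∘ₗ (traceZero K L).subtype ∘ₗ
        LinearMap.fst K (traceZero K L) L)

theorem mem_augmentPlane {Z : Submodule K (traceZero K L)} {ρ s : L} {v : Ambient K L} :
    v ∈ augmentPlane Z ρ s ↔
      v.1 ∈ Z ∧ frob K L (ρ * v.2) - ρ * v.2 = s * frob K L (v.1 : L) := by
  simp [augmentPlane, sub_eq_zero]

/-- The pairs `(Z, s)` for which the planes `augmentPlane Z ρ s` are used in the augmentation. -/
structure Admissible (Z : Submodule K (traceZero K L)) (s : L) : Prop where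
  ne_zero : s ≠ 0
  finrank_eq : finrank K Z = 2
  trace_eq : ∀ x ∈ Z, Algebra.trace K L (s * frob K L (x : L)) = 0
  moore_ne : ∀ a ∈ Z, ∀ b ∈ Z, moore K (a : L) (b : L) ≠ 0 →
    frob K L s * frob K L (frob K L (moore K (a : L) (b : L))) ≠ -(s * moore K (a : L) (b : L))

theorem augmentPlane_smul (Z : Submodule K (traceZero K L)) (ρ s : L) {c : K} (hc : c ≠ 0) :
    augmentPlane Z (c • ρ) (c • s) = augmentPlane Z ρ s := by
  ext v
  simp only [mem_augmentPlane, smul_mul_assoc, map_smul, ← smul_sub]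
  rw [(smul_right_injective L hc).eq_iff]

variable (hKL : finrank K L = 4)
include hKL

theorem mem_augmentPlane_of_fst_eq_zero {Z : Submodule K (traceZero K L)} {ρ s : L}
    {v : Ambient K L} (hv : v.1 = 0) :
    v ∈ augmentPlane Z ρ s ↔ ∃ c : K, algebraMap K L c = ρ * v.2 := by
  rw [mem_augmentPlane, hv]
  rw [← frob_eq_self_iff hKL]
  simp [sub_eq_zero]

theorem augmentPlane_inf_specialSolid {Z : Submodule K (traceZero K L)} {ρ s : L} (hρ : ρ ≠ 0) :
    augmentPlane Z ρ s ⊓ specialSolid K L = K ∙ ((0, ρ⁻¹) : Ambient K L) := by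
  ext v
  rw [Submodule.mem_inf, Submodule.mem_span_singleton, specialSolid, Submodule.mem_prod,
    Submodule.mem_bot]
  constructor
  · rintro ⟨h1, h2, -⟩
    obtain ⟨c, hc⟩ := (mem_augmentPlane_of_fst_eq_zero hKL h2).1 h1
    refine ⟨c, Prod.ext (by simp [h2]) ?_⟩
    simp only [Prod.smul_mk, Algebra.smul_def, hc]
    field_simp
  · rintro ⟨c, rfl⟩
    refine ⟨(mem_augmentPlane_of_fst_eq_zero hKL (by simp)).2 ⟨c, ?_⟩, by simp, by simp⟩
    simp only [Prod.smul_mk, Algebra.smul_def]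
    field_simp

theorem finrank_augmentPlane_inf_specialSolid {Z : Submodule K (traceZero K L)} {ρ s : L}
    (hρ : ρ ≠ 0) :
    finrank K (augmentPlane Z ρ s ⊓ specialSolid K L : Submodule K (Ambient K L)) = 1 := by
  rw [augmentPlane_inf_specialSolid hKL hρ]
  exact finrank_span_singleton (by simp [hρ])

theorem map_fst_augmentPlane {Z : Submodule K (traceZero K L)} {ρ s : L} (hρ : ρ ≠ 0)
    (h : Admissible Z s) : (augmentPlane Z ρ s).map (LinearMap.fst K _ _) = Z := by
  ext x
  rw [Submodule.mem_map]
  constructor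
  · rintro ⟨v, hv, rfl⟩
    exact (mem_augmentPlane.1 hv).1
  · intro hx
    obtain ⟨y, hy⟩ := exists_frob_sub_eq hKL (h.trace_eq x hx)
    refine ⟨(x, ρ⁻¹ * y), mem_augmentPlane.2 ⟨hx, ?_⟩, rfl⟩
    rw [mul_inv_cancel_left₀ hρ, hy]

theorem finrank_augmentPlane {Z : Submodule K (traceZero K L)} {ρ s : L} (hρ : ρ ≠ 0)
    (h : Admissible Z s) : finrank K (augmentPlane Z ρ s) = 3 := by
  have := finiteDimensional_of_finrank_eq_four hKL
  have h1 := finrank_eq_finrank_map_fst_add (augmentPlane Z ρ s)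
  have h2 := finrank_augmentPlane_inf_specialSolid hKL (Z := Z) (s := s) hρ
  rw [specialSolid] at h2
  rw [map_fst_augmentPlane hKL hρ h, h.finrank_eq, h2] at h1
  exact h1

/-- A line of the ambient space either projects injectively to `W` or meets the special solid. -/
theorem exists_moore_ne_zero_or_exists_fst_eq_zero {T : Submodule K (Ambient K L)}
    (hT : finrank K T = 2) :
    (∃ v ∈ T, ∃ w ∈ T, moore K (v.1 : L) (w.1 : L) ≠ 0) ∨
      ∃ v ∈ T, ∃ w ∈ T, v.1 = 0 ∧ v.2 ≠ 0 ∧ ∀ c : K, w ≠ c • v := by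
  obtain ⟨v, hvT, w, hwT, hb'⟩ := exists_pair_of_finrank_eq_two hT
  by_cases hv0 : v.1 = 0
  · refine .inr ⟨v, hvT, w, hwT, hv0, fun h => ?_, fun c hc => ?_⟩
    · have := hb' 1 0 (by simp [Prod.ext_iff, hv0, h])
      simp at this
    · have := hb' c (-1) (by simp [hc])
      simp at this
  by_cases hm : moore K (v.1 : L) (w.1 : L) = 0
  · obtain ⟨c, hc⟩ := exists_smul_of_moore_eq_zero hKL (by simpa using hv0) hm
    have hc' : w.1 = c • v.1 := Subtype.ext hc
    refine .inr ⟨w - c • v, T.sub_mem hwT (T.smul_mem _ hvT), v, hvT, by simp [hc'],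
      fun h => ?_, fun d hd => ?_⟩
    · have h0 : w - c • v = 0 := Prod.ext (by simp [hc']) h
      have := hb' (-c) 1 (by rw [← h0]; module)
      simp at this
    · have := hb' (1 + d * c) (-d) (by
        calc (1 + d * c) • v + (-d) • w = v - d • (w - c • v) := by module
          _ = 0 := by rw [← hd, sub_self])
      have h1 : d = 0 := by simpa using this.2
      simp [h1] at this
  · exact .inl ⟨v, hvT, w, hwT, hm⟩

end Planes

/-! ### Lines contained in two planes. -/

section Lines

variable {K L : Type*} [Field K] [Fintype K] [Field L] [Algebra K L]

/-- The bracket is the 3 × 3 Moore determinant of a, b, u. Frobenius shifts its rows, and on W the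
new row is minus the sum of the three old ones; the cyclic shift is even, so only the sign -1
remains. -/
theorem frob_det_of_mem_traceZero (hKL : finrank K L = 4) {a b u : L} (ha : a ∈ traceZero K L)
    (hb : b ∈ traceZero K L) (hu : u ∈ traceZero K L) :
    frob K L (u * frob K L (moore K a b) -
        frob K L u * (a * frob K L (frob K L b) - b * frob K L (frob K L a)) +
        frob K L (frob K L u) * moore K a b) =
      -(u * frob K L (moore K a b) -
        frob K L u * (a * frob K L (frob K L b) - b * frob K L (frob K L a)) +
        frob K L (frob K L u) * moore K a b) := by
  rw [mem_traceZero_iff hKL] at ha hb hu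
  simp only [moore, map_add, map_sub, map_mul, ha, hb, hu]
  ring

/-- In the Moore determinant of a, b, u with u = aβ - bα, the column of u equals β times that of a
minus α times that of b, except for an extra -s D^q in the last entry. Only that entry contributes.
-/
theorem mul_moore_mul_frob_moore {a b α β s : L} (hα : frob K L α - α = s * frob K L a)
    (hβ : frob K L β - β = s * frob K L b) :
    (a * β - b * α) * frob K L (moore K a b) -
        frob K L (a * β - b * α) * (a * frob K L (frob K L b) - b * frob K L (frob K L a)) +
        frob K L (frob K L (a * β - b * α)) * moore K a b =
      -(s * moore K a b * frob K L (moore K a b)) := by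
  rw [sub_eq_iff_eq_add] at hα hβ
  have hu : frob K L (a * β - b * α) = frob K L a * β - frob K L b * α := by
    simp only [map_sub, map_mul, hα, hβ]
    ring
  rw [hu]
  simp only [moore, map_sub, map_mul, hα, hβ]
  ring

section Plane

variable {Z : Submodule K (traceZero K L)} {ρ s : L} {v w : Ambient K L}

/-- Frobenius adds s a^q and s b^q to ρ times the second coordinates, and these contributions cancel
in the cross product. -/
theorem frob_cross_of_mem_augmentPlane (hv : v ∈ augmentPlane Z ρ s)
    (hw : w ∈ augmentPlane Z ρ s) :
    frob K L (ρ * ((v.1 : L) * w.2 - (w.1 : L) * v.2)) =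
      ρ * (frob K L (v.1 : L) * w.2 - frob K L (w.1 : L) * v.2) := by
  have h1 := (mem_augmentPlane.1 hv).2
  have h2 := (mem_augmentPlane.1 hw).2
  rw [map_mul] at h1 h2
  simp only [map_mul, map_sub]
  linear_combination frob K L (v.1 : L) * h2 - frob K L (w.1 : L) * h1

theorem cross_ne_zero_of_mem_augmentPlane (hρ : ρ ≠ 0) (hs : s ≠ 0)
    (hv : v ∈ augmentPlane Z ρ s) (hw : w ∈ augmentPlane Z ρ s)
    (h : moore K (v.1 : L) (w.1 : L) ≠ 0) :
    ρ * ((v.1 : L) * w.2 - (w.1 : L) * v.2) ≠ 0 := by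
  intro h0
  have h1 := frob_cross_of_mem_augmentPlane hv hw
  rw [h0, map_zero] at h1
  replace h0 := (mul_eq_zero.1 h0).resolve_left hρ
  replace h1 := (mul_eq_zero.1 h1.symm).resolve_left hρ
  have hv2 : v.2 = 0 := by
    refine (mul_eq_zero.1 (?_ : moore K (v.1 : L) (w.1 : L) * v.2 = 0)).resolve_left h
    rw [moore]
    linear_combination frob K L (v.1 : L) * h0 - (v.1 : L) * h1
  have hw2 : w.2 = 0 := by
    refine (mul_eq_zero.1 (?_ : moore K (v.1 : L) (w.1 : L) * w.2 = 0)).resolve_left h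
    rw [moore]
    linear_combination frob K L (w.1 : L) * h0 - (w.1 : L) * h1
  have h3 := (mem_augmentPlane.1 hv).2
  have h4 := (mem_augmentPlane.1 hw).2
  simp only [hv2, hw2, mul_zero, map_zero, sub_zero, zero_eq_mul, hs, false_or] at h3 h4
  simp [moore, h3, h4] at h

/-- If u lay in W, its determinant -s D D^q with a, b would be negated by Frobenius; cancelling D^q
gives the equation excluded by `Admissible.moore_ne`. -/
theorem cross_notMem_traceZero_of_mem_augmentPlane (hKL : finrank K L = 4)
    (hs : Admissible Z s) (hv : v ∈ augmentPlane Z ρ s) (hw : w ∈ augmentPlane Z ρ s)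
    (h : moore K (v.1 : L) (w.1 : L) ≠ 0) :
    ρ * ((v.1 : L) * w.2 - (w.1 : L) * v.2) ∉ traceZero K L := by
  intro hu
  obtain ⟨hvZ, hv2⟩ := mem_augmentPlane.1 hv
  obtain ⟨hwZ, hw2⟩ := mem_augmentPlane.1 hw
  have hc : ρ * ((v.1 : L) * w.2 - (w.1 : L) * v.2) =
      (v.1 : L) * (ρ * w.2) - (w.1 : L) * (ρ * v.2) := by ring
  rw [hc] at hu
  have h1 := frob_det_of_mem_traceZero hKL v.1.2 w.1.2 hu
  rw [mul_moore_mul_frob_moore hv2 hw2, map_neg, map_mul, map_mul] at h1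
  refine hs.moore_ne _ hvZ _ hwZ h (mul_right_cancel₀ (frob_ne_zero (K := K) h) ?_)
  linear_combination -h1

end Plane

theorem eq_of_gabidulinMap_eq {a₀ a₁ b₀ b₁ : L} {x y : traceZero K L}
    (h : moore K (x : L) (y : L) ≠ 0) (hx : gabidulinMap K a₀ a₁ x = gabidulinMap K b₀ b₁ x)
    (hy : gabidulinMap K a₀ a₁ y = gabidulinMap K b₀ b₁ y) : a₀ = b₀ ∧ a₁ = b₁ := by
  simp only [gabidulinMap_apply, ← frob_apply (K := K)] at hx hy
  constructor
  · refine mul_right_cancel₀ h ?_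
    rw [moore]
    linear_combination frob K L (y : L) * hx - frob K L (x : L) * hy
  · refine mul_right_cancel₀ h ?_
    rw [moore]
    linear_combination (x : L) * hy - (y : L) * hx

variable (hKL : finrank K L = 4)
include hKL

theorem moore_ne_zero_of_le_graph {T : Submodule K (Ambient K L)} (hT : finrank K T = 2)
    {f : traceZero K L →ₗ[K] L} (hf : T ≤ f.graph) :
    ∃ v ∈ T, ∃ w ∈ T, moore K (v.1 : L) (w.1 : L) ≠ 0 := by
  refine (exists_moore_ne_zero_or_exists_fst_eq_zero hKL hT).resolve_right ?_
  rintro ⟨v, hv, -, -, hv1, hv2, -⟩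
  have := (LinearMap.mem_graph_iff _ _).1 (hf hv)
  rw [hv1, map_zero] at this
  exact hv2 this

theorem eq_of_le_liftedGabidulin {T E E' : Submodule K (Ambient K L)} (hT : finrank K T = 2)
    (hE : E ∈ liftedGabidulin K L) (hE' : E' ∈ liftedGabidulin K L) (hTE : T ≤ E)
    (hTE' : T ≤ E') : E = E' := by
  obtain ⟨a₀, a₁, rfl⟩ := hE
  obtain ⟨b₀, b₁, rfl⟩ := hE'
  obtain ⟨v, hv, w, hw, h⟩ := moore_ne_zero_of_le_graph hKL hT hTE
  have hx := ((LinearMap.mem_graph_iff _ _).1 (hTE hv)).symm.trans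
    ((LinearMap.mem_graph_iff _ _).1 (hTE' hv))
  have hy := ((LinearMap.mem_graph_iff _ _).1 (hTE hw)).symm.trans
    ((LinearMap.mem_graph_iff _ _).1 (hTE' hw))
  obtain ⟨rfl, rfl⟩ := eq_of_gabidulinMap_eq h hx hy
  rfl

theorem mem_removedPlanes_of_le {T E : Submodule K (Ambient K L)} (hT : finrank K T = 2)
    (hE : E ∈ liftedGabidulin K L) {Z : Submodule K (traceZero K L)} {ρ s : L} (hρ : ρ ≠ 0)
    (hs : Admissible Z s) (hTE : T ≤ E) (hTE' : T ≤ augmentPlane Z ρ s) :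
    E ∈ removedPlanes K L := by
  obtain ⟨a₀, a₁, rfl⟩ := hE
  obtain ⟨v, hv, w, hw, h⟩ := moore_ne_zero_of_le_graph hKL hT hTE
  have hx := (LinearMap.mem_graph_iff _ _).1 (hTE hv)
  have hy := (LinearMap.mem_graph_iff _ _).1 (hTE hw)
  simp only [gabidulinMap_apply, ← frob_apply (K := K)] at hx hy
  have hu := frob_cross_of_mem_augmentPlane (hTE' hv) (hTE' hw)
  -- Cramer's rule gives a₁ = u/(ρD) and a₀ = -u^q/(ρD), where u is ρ times the cross product of v
  -- and w.
  refine ⟨(ρ * moore K (v.1 : L) (w.1 : L))⁻¹, _, inv_ne_zero (mul_ne_zero hρ h),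
    cross_notMem_traceZero_of_mem_augmentPlane hKL hs (hTE' hv) (hTE' hw) h, ?_⟩
  rw [binomialMap, ← frob_apply (K := K), hu]
  congr 2
  · field_simp
    rw [hx, hy, moore]
    ring
  · field_simp
    rw [hx, hy, moore]
    ring

/-- Either ρ and ρ' both satisfy the Frobenius relation for the same nonzero cross product, or they
both carry the same point of S into K. In both cases ρ'/ρ ∈ K, and a vector outside S then transfers
the ratio to s. The lines Z, Z' play no role. -/
theorem exists_smul_of_le_augmentPlane {T : Submodule K (Ambient K L)} (hT : finrank K T = 2)
    {Z Z' : Submodule K (traceZero K L)} {ρ s ρ' s' : L} (hρ : ρ ≠ 0) (hρ' : ρ' ≠ 0)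
    (hs : s ≠ 0) (hTE : T ≤ augmentPlane Z ρ s)
    (hTE' : T ≤ augmentPlane Z' ρ' s') : ∃ c : K, c ≠ 0 ∧ ρ' = c • ρ ∧ s' = c • s := by
  have key : ∀ (c : K), ρ' = c • ρ → (∃ v ∈ T, v.1 ≠ 0) →
      ∃ c : K, c ≠ 0 ∧ ρ' = c • ρ ∧ s' = c • s := by
    rintro c hc ⟨v, hv, hv1⟩
    refine ⟨c, fun h0 => hρ' (by rw [hc, h0, zero_smul]), hc, ?_⟩
    have h1 := (mem_augmentPlane.1 (hTE hv)).2
    have h2 := (mem_augmentPlane.1 (hTE' hv)).2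
    rw [hc, smul_mul_assoc, map_smul, ← smul_sub, h1, ← smul_mul_assoc] at h2
    exact (mul_right_cancel₀ (frob_ne_zero (by simpa using hv1)) h2).symm
  rcases exists_moore_ne_zero_or_exists_fst_eq_zero hKL hT with
    ⟨v, hv, w, hw, h⟩ | ⟨v, hv, w, hw, hv1, hv2, hvw⟩
  · have hu := frob_cross_of_mem_augmentPlane (hTE hv) (hTE hw)
    have hu' := frob_cross_of_mem_augmentPlane (hTE' hv) (hTE' hw)
    have hu0 := cross_ne_zero_of_mem_augmentPlane hρ hs (hTE hv) (hTE hw) h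
    obtain ⟨c, hc⟩ := exists_smul_of_moore_eq_zero hKL (a := ρ *
      ((v.1 : L) * w.2 - (w.1 : L) * v.2)) (b := ρ' * ((v.1 : L) * w.2 - (w.1 : L) * v.2)) hu0
      (by rw [moore, hu, hu']; ring)
    refine key c (mul_right_cancel₀ (right_ne_zero_of_mul hu0) ?_) ⟨v, hv, fun h0 => h ?_⟩
    · rw [hc, smul_mul_assoc]
    · simp [h0, moore]
  · obtain ⟨d, hd⟩ := (mem_augmentPlane_of_fst_eq_zero hKL hv1).1 (hTE hv)
    obtain ⟨d', hd'⟩ := (mem_augmentPlane_of_fst_eq_zero hKL hv1).1 (hTE' hv)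
    have hd0 : algebraMap K L d ≠ 0 := by rw [hd]; exact mul_ne_zero hρ hv2
    refine key (d' / d) (mul_right_cancel₀ hv2 ?_) ⟨w, hw, fun hw1 => ?_⟩
    · rw [← hd', Algebra.smul_def, mul_assoc, ← hd, map_div₀, div_mul_cancel₀ _ hd0]
    · obtain ⟨e, he⟩ := (mem_augmentPlane_of_fst_eq_zero hKL hw1).1 (hTE hw)
      refine hvw (e / d) (Prod.ext (by simp [hv1, hw1]) (mul_left_cancel₀ hρ ?_))
      rw [Prod.smul_snd, Algebra.smul_def, mul_left_comm, ← hd, map_div₀, div_mul_cancel₀ _ hd0, he]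

end Lines

/-! ### One line of W for each good parameter. -/

section Selection

variable {K L : Type*} [Field K] [Fintype K] [Field L] [Algebra K L] (hKL : finrank K L = 4)

include hKL in
theorem natCard_traceZero : Nat.card (traceZero K L) = Fintype.card K ^ 3 := by
  have := finiteDimensional_of_finrank_eq_four hKL
  rw [Module.natCard_eq_pow_finrank (K := K), finrank_traceZero hKL, Nat.card_eq_fintype_card]

include hKL in
open Polynomial in
-- A nonzero polynomial of degree at most q² cannot vanish at the q³ elements of W.
theorem eq_zero_of_forall_mem_traceZero {c₀ c₁ c₂ : L}
    (h : ∀ x ∈ traceZero K L, c₀ * x + c₁ * frob K L x + c₂ * frob K L (frob K L x) = 0) :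
    c₀ = 0 ∧ c₁ = 0 ∧ c₂ = 0 := by
  classical
  have := finite_of_finrank_eq_four hKL
  have := Fintype.ofFinite L
  have hq : 1 < Fintype.card K := Fintype.one_lt_card
  set q := Fintype.card K with hqdef
  have hq2 : q < q ^ 2 := by nlinarith
  set p : L[X] := C c₀ * X ^ 1 + C c₁ * X ^ q + C c₂ * X ^ (q ^ 2) with hp
  have hp0 : p = 0 := by
    by_contra hp0
    have h1 : ((traceZero K L : Set L).toFinset) ⊆ p.roots.toFinset := by
      intro x hx
      rw [Multiset.mem_toFinset, mem_roots hp0, IsRoot.def, hp]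
      have := h x (by simpa using hx)
      simpa only [eval_add, eval_mul, eval_C, eval_pow, eval_X, pow_one, pow_two, pow_mul,
        frob_apply] using this
    have h2 := (Finset.card_le_card h1).trans
      ((Multiset.toFinset_card_le _).trans (card_roots' _))
    rw [← Set.ncard_eq_toFinset_card', ← Nat.card_coe_set_eq] at h2
    have h3 : p.natDegree ≤ q ^ 2 := by
      rw [hp]
      compute_degree
      all_goals omega
    have h4 : Nat.card (traceZero K L : Set L) = q ^ 3 := natCard_traceZero hKL
    have h5 : q ^ 2 < q ^ 3 := Nat.pow_lt_pow_right hq (by norm_num)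
    omega
  have hc (n : ℕ) : p.coeff n = 0 := by rw [hp0, coeff_zero]
  have hc0 := hc 1
  have hc1 := hc q
  have hc2 := hc (q ^ 2)
  simp only [hp, coeff_add, coeff_C_mul, coeff_X_pow] at hc0 hc1 hc2
  rw [if_true, if_neg (by omega), if_neg (by omega)] at hc0
  rw [if_neg (by omega), if_true, if_neg (by omega)] at hc1
  rw [if_neg (by omega), if_neg (by omega), if_true] at hc2
  simp at hc0 hc1 hc2
  exact ⟨hc0, hc1, hc2⟩

include hKL in
theorem exists_moore_add_frob_frob_ne_zero :
    ∃ a b : traceZero K L,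
      moore K (a : L) (b : L) + frob K L (frob K L (moore K (a : L) (b : L))) ≠ 0 := by
  by_contra! h
  have h1 : ∀ a ∈ traceZero K L, a + frob K L a = 0 := by
    intro a ha
    -- For fixed a, eliminating third Frobenius powers on W turns D + D^(q²) into a q-polynomial in
    -- b with these coefficients.
    refine (eq_zero_of_forall_mem_traceZero hKL (c₀ := -(frob K L a + frob K L (frob K L a)))
      (c₁ := a - frob K L (frob K L a)) (c₂ := a + frob K L a) fun b hb => ?_).2.2
    have := h ⟨a, ha⟩ ⟨b, hb⟩
    rw [mem_traceZero_iff hKL] at ha hb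
    simp only [moore, map_sub, map_mul, ha, hb] at this
    linear_combination this
  have h2 := eq_zero_of_forall_mem_traceZero hKL (c₀ := 1) (c₁ := 1) (c₂ := 0)
    (fun x hx => by simpa using h1 x hx)
  exact one_ne_zero h2.1

/-- A line of `PG(W)` on which the Moore determinant satisfies `D ^ (q ^ 2) ≠ -D`. -/
def IsNondegenerate (Z : Submodule K (traceZero K L)) : Prop :=
  finrank K Z = 2 ∧ ∀ a ∈ Z, ∀ b ∈ Z, moore K (a : L) (b : L) ≠ 0 →
    moore K (a : L) (b : L) + frob K L (frob K L (moore K (a : L) (b : L))) ≠ 0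

theorem finrank_span_pair_of_moore_ne_zero {a b : traceZero K L}
    (h : moore K (a : L) (b : L) ≠ 0) : finrank K (Submodule.span K {a, b}) = 2 := by
  have hli : LinearIndependent K ![a, b] := by
    refine (LinearIndependent.pair_iff' fun h0 => h (by simp [h0, moore])).2 fun c hc => h ?_
    rw [← hc]
    simp only [moore, Submodule.coe_smul, Algebra.smul_def, map_mul, AlgHom.commutes]
    ring
  have := finrank_span_eq_card hli
  rwa [Matrix.range_cons_cons_empty, Fintype.card_fin] at this

include hKL in
theorem exists_isNondegenerate : ∃ Z : Submodule K (traceZero K L), IsNondegenerate Z := by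
  obtain ⟨a, b, h⟩ := exists_moore_add_frob_frob_ne_zero hKL
  refine ⟨Submodule.span K {a, b}, finrank_span_pair_of_moore_ne_zero fun h0 => h (by simp [h0]),
    fun x hx y hy hxy => ?_⟩
  obtain ⟨c, d, rfl⟩ := Submodule.mem_span_pair.1 hx
  obtain ⟨c', d', rfl⟩ := Submodule.mem_span_pair.1 hy
  -- D is alternating and K-bilinear, so on the span of a, b it changes only by a factor in K, which
  -- Frobenius fixes.
  have hm : moore K ((c • a + d • b : traceZero K L) : L) ((c' • a + d' • b : traceZero K L) : L) =
      (c * d' - d * c') • moore K (a : L) (b : L) := by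
    simp only [moore, Submodule.coe_add, Submodule.coe_smul, map_add, Algebra.smul_def,
      map_sub, map_mul, AlgHom.commutes]
    ring
  rw [hm] at hxy ⊢
  rw [map_smul, map_smul, ← smul_add]
  exact smul_ne_zero (left_ne_zero_of_smul hxy) h

open Classical in
/-- The line of `PG(W)` attached to `s`: the kernel of `x ↦ Tr (s x ^ q)` if `s ∉ K`, and the
given line `Z₀` otherwise. -/
noncomputable def selectedLine (Z₀ : Submodule K (traceZero K L)) (s : L) :
    Submodule K (traceZero K L) :=
  if frob K L s = s then Z₀ else
    LinearMap.ker (Algebra.trace K L ∘ₗ LinearMap.mulLeft K s ∘ₗ (frob K L).toLinearMap ∘ₗ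
      (traceZero K L).subtype)

theorem selectedLine_smul (Z₀ : Submodule K (traceZero K L)) (s : L) {c : K} (hc : c ≠ 0) :
    selectedLine Z₀ (c • s) = selectedLine Z₀ s := by
  rw [selectedLine, selectedLine, map_smul, (smul_right_injective L hc).eq_iff]
  congr 1
  ext x
  simp [hc]

/-- The parameters `s ≠ 0` with `s ∈ K` or `s ^ (1 + q ^ 2) ∉ K`. -/
def goodParameters (K L : Type*) [Field K] [Fintype K] [Field L] [Algebra K L] : Set L :=
  {s | s ≠ 0 ∧ (frob K L s = s ∨
    frob K L (s * frob K L (frob K L s)) ≠ s * frob K L (frob K L s))}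

theorem smul_mem_goodParameters {s : L} (hs : s ∈ goodParameters K L) {c : K} (hc : c ≠ 0) :
    c • s ∈ goodParameters K L := by
  refine ⟨smul_ne_zero hc hs.1, hs.2.imp (fun h => by rw [map_smul, h]) fun h => ?_⟩
  have : c • s * frob K L (frob K L (c • s)) = (c * c) • (s * frob K L (frob K L s)) := by
    rw [map_smul, map_smul, smul_mul_smul_comm]
  rwa [this, map_smul, (smul_right_injective L (mul_ne_zero hc hc)).ne_iff]

include hKL in
theorem admissible_selectedLine {Z₀ : Submodule K (traceZero K L)} (hZ₀ : IsNondegenerate Z₀)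
    {s : L} (hs : s ∈ goodParameters K L) : Admissible (selectedLine Z₀ s) s := by
  have := finiteDimensional_of_finrank_eq_four hKL
  by_cases hsK : frob K L s = s
  · rw [selectedLine, if_pos hsK]
    refine ⟨hs.1, hZ₀.1, fun x _ => ?_, fun a ha b hb h h0 => hZ₀.2 a ha b hb h ?_⟩
    · obtain ⟨c, rfl⟩ := (frob_eq_self_iff hKL).1 hsK
      rw [← Algebra.smul_def, map_smul, trace_frob hKL, LinearMap.mem_ker.1 x.2, smul_zero]
    · refine (mul_eq_zero.1 (?_ : s * _ = 0)).resolve_left hs.1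
      rw [hsK] at h0
      linear_combination h0
  · rw [selectedLine, if_neg hsK]
    have hne := hs.2.resolve_left hsK
    refine ⟨hs.1, ?_, fun x hx => by simpa using hx, fun a _ b _ h h0 => hne ?_⟩
    · have h1 : (Algebra.trace K L ∘ₗ LinearMap.mulLeft K s ∘ₗ (frob K L).toLinearMap ∘ₗ
          (traceZero K L).subtype) ≠ 0 := by
        intro h0
        refine hsK (frob_eq_self_of_trace_mul_frob hKL fun x hx => ?_)
        simpa using LinearMap.congr_fun h0 ⟨x, hx⟩
      have h2 := Module.Dual.finrank_ker_add_one_of_ne_zero h1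
      rw [finrank_traceZero hKL] at h2
      omega
    · set D := moore K (a : L) (b : L)
      -- Applying x ↦ x^(q²) to s^q D^(q²) = -sD gives a second equation; eliminating D^(q²) yields
      -- s^(q+q³) = s^(1+q²), so s^(1+q²) would lie in K.
      have h1 := congrArg (fun z => frob K L (frob K L z)) h0
      simp only [map_mul, map_neg, frob_frob_frob_frob hKL D] at h1
      rw [map_mul]
      refine mul_right_cancel₀ h ?_
      linear_combination frob K L s * h1 - frob K L (frob K L s) * h0

/-- The planes used in the augmentation. -/
def augmentation (Z₀ : Submodule K (traceZero K L)) : Set (Submodule K (Ambient K L)) :=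
  {E | ∃ ρ s : L, ρ ≠ 0 ∧ s ∈ goodParameters K L ∧ E = augmentPlane (selectedLine Z₀ s) ρ s}

end Selection

/-! ### The code property. -/

section Code

variable {K L : Type*} [Field K] [Fintype K] [Field L] [Algebra K L] (hKL : finrank K L = 4)
include hKL

theorem finrank_eq_three_of_mem_liftedGabidulin {E : Submodule K (Ambient K L)}
    (hE : E ∈ liftedGabidulin K L) : finrank K E = 3 := by
  obtain ⟨a₀, a₁, rfl⟩ := hE
  rw [LinearMap.graph_eq_range_prod, LinearMap.finrank_range_of_inj, finrank_traceZero hKL]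
  intro x y h
  exact congrArg Prod.fst h

theorem eq_of_le_augmentation {Z₀ : Submodule K (traceZero K L)}
    {T E E' : Submodule K (Ambient K L)}
    (hT : finrank K T = 2) (hE : E ∈ augmentation Z₀) (hE' : E' ∈ augmentation Z₀) (hTE : T ≤ E)
    (hTE' : T ≤ E') : E = E' := by
  obtain ⟨ρ, s, hρ, hs, rfl⟩ := hE
  obtain ⟨ρ', s', hρ', -, rfl⟩ := hE'
  obtain ⟨c, hc, rfl, rfl⟩ := exists_smul_of_le_augmentPlane hKL hT hρ hρ' hs.1 hTE hTE'
  rw [selectedLine_smul _ _ hc, augmentPlane_smul _ _ _ hc]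

theorem eq_of_le_expurgatedCode_union {Z₀ : Submodule K (traceZero K L)} (hZ₀ : IsNondegenerate Z₀)
    {T E E' : Submodule K (Ambient K L)} (hT : finrank K T = 2)
    (hE : E ∈ expurgatedCode K L ∪ augmentation Z₀)
    (hE' : E' ∈ expurgatedCode K L ∪ augmentation Z₀) (hTE : T ≤ E) (hTE' : T ≤ E') : E = E' := by
  have mixed : ∀ F ∈ expurgatedCode K L, ∀ F' ∈ augmentation Z₀, T ≤ F → T ≤ F' → False := by
    rintro F hF _ ⟨ρ, s, hρ, hs, rfl⟩ hTF hTF'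
    exact hF.2 (mem_removedPlanes_of_le hKL hT hF.1 hρ (admissible_selectedLine hKL hZ₀ hs) hTF hTF')
  rcases hE with hE | hE <;> rcases hE' with hE' | hE'
  · exact eq_of_le_liftedGabidulin hKL hT hE.1 hE'.1 hTE hTE'
  · exact (mixed _ hE _ hE' hTE hTE').elim
  · exact (mixed _ hE' _ hE hTE' hTE).elim
  · exact eq_of_le_augmentation hKL hT hE hE' hTE hTE'

theorem exists_moore_ne_zero : ∃ a b : traceZero K L, moore K (a : L) (b : L) ≠ 0 := by
  obtain ⟨a, b, h⟩ := exists_moore_add_frob_frob_ne_zero hKL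
  exact ⟨a, b, fun h0 => h (by simp [h0])⟩

theorem graph_gabidulinMap_inj {a₀ a₁ b₀ b₁ : L}
    (h : (gabidulinMap K a₀ a₁).graph = (gabidulinMap K b₀ b₁).graph) : a₀ = b₀ ∧ a₁ = b₁ := by
  obtain ⟨x, y, hxy⟩ := exists_moore_ne_zero hKL
  have hf (z : traceZero K L) : gabidulinMap K a₀ a₁ z = gabidulinMap K b₀ b₁ z := by
    have : (z, gabidulinMap K a₀ a₁ z) ∈ (gabidulinMap K b₀ b₁).graph := by
      rw [← h, LinearMap.mem_graph_iff]
    exact (LinearMap.mem_graph_iff _ _).1 this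
  exact eq_of_gabidulinMap_eq hxy (hf x) (hf y)

/-- Two members of the expurgated code meet in a point. -/
theorem exists_inter_expurgatedCode :
    ∃ E ∈ expurgatedCode K L, ∃ E' ∈ expurgatedCode K L, E ≠ E' ∧
      ∃ T : Submodule K (Ambient K L), finrank K T = 1 ∧ T ≤ E ∧ T ≤ E' := by
  obtain ⟨u, _, h⟩ := exists_moore_ne_zero hKL
  have hu : (u : L) ≠ 0 := fun h0 => h (by simp [moore, h0])
  -- The map x ↦ u x^q - u^q x vanishes at x = u, so it meets the zero map there. Taking u ∈ W keeps
  -- it from being removed, since a binomial determines u up to Kˣ.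
  refine ⟨(gabidulinMap K 0 0).graph, ⟨⟨0, 0, rfl⟩, ?_⟩,
    (gabidulinMap K (-frob K L (u : L)) u).graph, ⟨⟨_, _, rfl⟩, ?_⟩, ?_, K ∙ (u, 0), ?_, ?_, ?_⟩
  · rintro ⟨r, v, hr, hv, hrv⟩
    have := (graph_gabidulinMap_inj hKL hrv).2.symm
    rw [(mul_eq_zero.1 this).resolve_left hr] at hv
    exact hv (zero_mem _)
  · rintro ⟨r, v, hr, hv, hrv⟩
    obtain ⟨h1, h2⟩ := graph_gabidulinMap_inj hKL hrv
    rw [← frob_apply (K := K), neg_inj] at h1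
    obtain ⟨c, rfl⟩ := exists_smul_of_moore_eq_zero hKL hu (b := v) (by
      refine (mul_eq_zero.1 (?_ : r * _ = 0)).resolve_left hr
      rw [moore]
      linear_combination frob K L (u : L) * h2 - (u : L) * h1)
    exact hv (Submodule.smul_mem _ _ u.2)
  · intro h0
    exact hu (graph_gabidulinMap_inj hKL h0).2.symm
  · exact finrank_span_singleton (by simpa using hu)
  · rw [Submodule.span_singleton_le_iff_mem, LinearMap.mem_graph_iff, gabidulinMap_apply]
    simp
  · rw [Submodule.span_singleton_le_iff_mem, LinearMap.mem_graph_iff, gabidulinMap_apply,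
      ← frob_apply (K := K)]
    ring

/-- Stated for intermediate sets so as to cover both the expurgated code and its augmentation; the
pair of planes refuting t = 1 already lies in the former. -/
theorem isPlaneSubspaceCode_of_subset {C : Set (Submodule K (Ambient K L))}
    {Z₀ : Submodule K (traceZero K L)} (hZ₀ : IsNondegenerate Z₀)
    (h₁ : expurgatedCode K L ⊆ C) (h₂ : C ⊆ expurgatedCode K L ∪ augmentation Z₀) :
    IsPlaneSubspaceCode 2 C := by
  refine ⟨fun E hE => ?_, ⟨two_pos, fun T hT E hE E' hE' hTE hTE' =>
    eq_of_le_expurgatedCode_union hKL hZ₀ hT (h₂ hE) (h₂ hE') hTE hTE'⟩, ?_⟩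
  · rcases h₂ hE with hE | ⟨ρ, s, hρ, hs, rfl⟩
    · exact finrank_eq_three_of_mem_liftedGabidulin hKL hE.1
    · exact finrank_augmentPlane hKL hρ (admissible_selectedLine hKL hZ₀ hs)
  · rintro n ⟨hn, h⟩
    by_contra! hn2
    obtain rfl : n = 1 := by omega
    obtain ⟨E, hE, E', hE', hne, T, hT, hTE, hTE'⟩ := exists_inter_expurgatedCode hKL
    exact hne (h T hT E (h₁ hE) E' (h₁ hE') hTE hTE')

theorem disjoint_liftedGabidulin_augmentation (Z₀ : Submodule K (traceZero K L)) :
    Disjoint (liftedGabidulin K L) (augmentation Z₀) := by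
  rw [Set.disjoint_left]
  rintro _ ⟨a₀, a₁, rfl⟩ ⟨ρ, s, hρ, -, h⟩
  have h1 : ((0, ρ⁻¹) : Ambient K L) ∈ augmentPlane (selectedLine Z₀ s) ρ s :=
    (mem_augmentPlane_of_fst_eq_zero hKL rfl).2 ⟨1, by simp [hρ]⟩
  rw [← h, LinearMap.mem_graph_iff, map_zero] at h1
  exact inv_ne_zero hρ h1

end Code

/-! ### Invariance under Σ. -/

section Invariance

theorem mem_map_sigmaEquiv {K L : Type*} [Field K] [Field L] [Algebra K L] {r : Lˣ}
    {E : Submodule K (Ambient K L)} {v : Ambient K L} :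
    v ∈ E.map (sigmaEquiv K r : Ambient K L →ₗ[K] Ambient K L) ↔
      ((v.1, (r : L)⁻¹ * v.2) : Ambient K L) ∈ E := by
  rw [Submodule.mem_map]
  constructor
  · rintro ⟨w, hw, rfl⟩
    simpa [sigmaEquiv_apply] using hw
  · intro h
    exact ⟨_, h, by simp [sigmaEquiv_apply]⟩

theorem map_sigmaEquiv_inv_map {K L : Type*} [Field K] [Field L] [Algebra K L]
    (r : Lˣ) (E : Submodule K (Ambient K L)) :
    (E.map (sigmaEquiv K r : Ambient K L →ₗ[K] Ambient K L)).map
      (sigmaEquiv K r⁻¹ : Ambient K L →ₗ[K] Ambient K L) = E := by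
  ext v
  rw [mem_map_sigmaEquiv, mem_map_sigmaEquiv]
  simp

variable {K L : Type*} [Field K] [Fintype K] [Field L] [Algebra K L]

theorem map_sigmaEquiv_graph (r : Lˣ) (a₀ a₁ : L) :
    (gabidulinMap K a₀ a₁).graph.map (sigmaEquiv K r : Ambient K L →ₗ[K] Ambient K L) =
      (gabidulinMap K (r * a₀) (r * a₁)).graph := by
  ext v
  rw [mem_map_sigmaEquiv, LinearMap.mem_graph_iff, LinearMap.mem_graph_iff, gabidulinMap_apply,
    gabidulinMap_apply, inv_mul_eq_iff_eq_mul₀ r.ne_zero]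
  ring_nf

theorem map_sigmaEquiv_augmentPlane (r : Lˣ) (Z : Submodule K (traceZero K L)) (ρ s : L) :
    (augmentPlane Z ρ s).map (sigmaEquiv K r : Ambient K L →ₗ[K] Ambient K L) =
      augmentPlane Z (ρ * (r : L)⁻¹) s := by
  ext v
  rw [mem_map_sigmaEquiv, mem_augmentPlane, mem_augmentPlane, mul_assoc]

theorem map_sigmaEquiv_mem_removedPlanes {r : Lˣ} {E : Submodule K (Ambient K L)}
    (hE : E ∈ removedPlanes K L) :
    E.map (sigmaEquiv K r : Ambient K L →ₗ[K] Ambient K L) ∈ removedPlanes K L := by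
  obtain ⟨t, u, ht, hu, rfl⟩ := hE
  refine ⟨r * t, u, mul_ne_zero r.ne_zero ht, hu, ?_⟩
  rw [binomialMap, binomialMap, map_sigmaEquiv_graph]
  ring_nf

theorem isSigmaInvariant_expurgatedCode_union (Z₀ : Submodule K (traceZero K L)) :
    IsSigmaInvariant K (expurgatedCode K L ∪ augmentation Z₀) := by
  have key : ∀ (r : Lˣ), ∀ E ∈ expurgatedCode K L ∪ augmentation Z₀,
      E.map (sigmaEquiv K r : Ambient K L →ₗ[K] Ambient K L) ∈
        expurgatedCode K L ∪ augmentation Z₀ := by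
    rintro r _ (⟨⟨a₀, a₁, rfl⟩, hE⟩ | ⟨ρ, s, hρ, hs, rfl⟩)
    · refine .inl ⟨⟨_, _, map_sigmaEquiv_graph r a₀ a₁⟩, fun h => hE ?_⟩
      have := map_sigmaEquiv_mem_removedPlanes (r := r⁻¹) h
      rwa [map_sigmaEquiv_inv_map] at this
    · exact .inr ⟨_, s, mul_ne_zero hρ (inv_ne_zero r.ne_zero), hs,
        map_sigmaEquiv_augmentPlane r _ ρ s⟩
  refine fun r => Set.Subset.antisymm (Set.image_subset_iff.2 fun E hE => key r E hE)
    fun E hE => ⟨_, key r⁻¹ E hE, ?_⟩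
  have := map_sigmaEquiv_inv_map r⁻¹ E
  rwa [inv_inv] at this

end Invariance

/-! ### Counting parameters and planes. -/

section Counting

theorem exists_eq_span_singleton_of_finrank_eq_one {K V : Type*} [Field K] [AddCommGroup V]
    [Module K V] {P : Submodule K V} (hP : finrank K P = 1) : ∃ v, v ≠ 0 ∧ P = K ∙ v := by
  obtain ⟨v, hv0, hv⟩ := finrank_eq_one_iff'.1 hP
  refine ⟨v, by simpa using hv0, le_antisymm (fun w hw => ?_) (by simp)⟩
  obtain ⟨c, hc⟩ := hv ⟨w, hw⟩
  exact Submodule.mem_span_singleton.2 ⟨c, congrArg Subtype.val hc⟩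

theorem ncard_eq_mul_ncard_image {α β : Type*} {A : Set α} (hA : A.Finite) (f : α → β) {k : ℕ}
    (h : ∀ a ∈ A, {b ∈ A | f b = f a}.ncard = k) : A.ncard = k * (f '' A).ncard := by
  classical
  lift A to Finset α using hA
  rw [← Finset.coe_image, Set.ncard_coe_finset, Set.ncard_coe_finset,
    Finset.card_eq_sum_card_image f A, Finset.sum_const_nat (m := k), mul_comm]
  intro b hb
  obtain ⟨a, ha, rfl⟩ := Finset.mem_image.1 hb
  rw [← h a ha, ← Set.ncard_coe_finset]
  simp

theorem ncard_pow_eq_one {L : Type*} [Field L] [Finite L] {d : ℕ} (hd : d ∣ Nat.card L - 1)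
    (hd0 : d ≠ 0) : {s : L | s ^ d = 1}.ncard = d := by
  have h1 : {s : L | s ^ d = 1} =
      Units.val '' ((powMonoidHom d : Lˣ →* Lˣ).ker : Set Lˣ) := by
    ext s
    simp only [Set.mem_ofPred_eq, Set.mem_image, SetLike.mem_coe, MonoidHom.mem_ker,
      powMonoidHom_apply]
    constructor
    · intro h
      have hs : s ≠ 0 := by
        rintro rfl
        simp [hd0] at h
      exact ⟨Units.mk0 s hs, Units.ext (by simpa using h), rfl⟩
    · rintro ⟨u, hu, rfl⟩
      rw [← Units.val_pow_eq_pow_val, hu, Units.val_one]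
  rw [h1, Set.ncard_image_of_injective _ Units.val_injective, ← Nat.card_coe_set_eq]
  refine (IsCyclic.card_powMonoidHom_ker Lˣ d).trans ?_
  rw [Nat.card_units]
  exact Nat.gcd_eq_right hd

theorem ncard_ne_zero {F : Type*} [Field F] [Finite F] :
    {x : F | x ≠ 0}.ncard = Nat.card F - 1 := by
  have := Set.ncard_compl ({0} : Set F)
  rwa [Set.ncard_singleton] at this

variable {K L : Type*} [Field K] [Fintype K] [Field L] [Algebra K L]

theorem removedPlanes_subset : removedPlanes K L ⊆ liftedGabidulin K L := by
  rintro _ ⟨r, u, -, -, rfl⟩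
  exact ⟨_, _, rfl⟩

variable (hKL : finrank K L = 4)
include hKL

/-- The nonzero s with s^(1+q²) ∈ K are the (q - 1)(q² + 1) roots of unity of that order. Of these
only the q - 1 elements of Kˣ are good, so (q - 1)q² of the q⁴ - 1 nonzero elements are lost. -/
theorem ncard_goodParameters :
    ((goodParameters K L).ncard : ℤ) = ((Fintype.card K : ℤ) - 1) *
      ((Fintype.card K : ℤ) ^ 3 + Fintype.card K + 1) := by
  have := finite_of_finrank_eq_four hKL
  obtain ⟨n, hn⟩ : ∃ n, Fintype.card K = n + 1 :=
    Nat.exists_eq_add_one_of_ne_zero Fintype.card_ne_zero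
  have hn0 : n ≠ 0 := by
    have := Fintype.one_lt_card (α := K)
    omega
  have hcard : Nat.card L - 1 = n * ((n + 1) ^ 3 + (n + 1) ^ 2 + (n + 1) + 1) := by
    rw [natCard_of_finrank_eq_four hKL, hn, Nat.sub_eq_iff_eq_add (Nat.pos_of_ne_zero (by simp))]
    ring
  set A : Set L := {s | s ^ (n * ((n + 1) ^ 2 + 1)) = 1}
  set B : Set L := {s | s ^ n = 1}
  -- With n = q - 1, the cofactor n + 2 = q + 1 is (q⁴ - 1)/((q - 1)(q² + 1)).
  have hA : A.ncard = n * ((n + 1) ^ 2 + 1) :=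
    ncard_pow_eq_one ⟨n + 2, by rw [hcard]; ring⟩ (by positivity)
  have hB : B.ncard = n := ncard_pow_eq_one ⟨_, hcard⟩ hn0
  have hBA : B ⊆ A := fun s (hs : s ^ n = 1) => by
    change s ^ (n * ((n + 1) ^ 2 + 1)) = 1
    rw [pow_mul, hs, one_pow]
  have hmem {x : L} (hx : x ≠ 0) : frob K L x = x ↔ x ^ n = 1 := by
    rw [frob_apply, hn, pow_succ, mul_eq_right₀ hx]
  have hmemA {s : L} (hs : s ≠ 0) :
      frob K L (s * frob K L (frob K L s)) = s * frob K L (frob K L s) ↔ s ∈ A := by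
    have hs' : s * frob K L (frob K L s) = s ^ ((n + 1) ^ 2 + 1) := by
      rw [frob_apply, frob_apply, hn, ← pow_mul]
      ring
    rw [hs', hmem (pow_ne_zero _ hs), ← pow_mul, mul_comm]
    rfl
  have hA0 : A ⊆ {x | x ≠ 0} := by
    rintro s (hs : s ^ _ = 1) rfl
    rw [zero_pow (by positivity)] at hs
    exact zero_ne_one hs
  have hgood : goodParameters K L = {x | x ≠ 0} \ (A \ B) := by
    ext s
    simp only [goodParameters, Set.mem_ofPred_eq, Set.mem_sdiff, not_and, not_not]
    refine and_congr_right fun hs => ?_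
    rw [hmem hs, ne_eq, hmemA hs, or_comm, ← imp_iff_not_or]
    rfl
  have h1 := Set.ncard_sdiff_add_ncard_of_subset hBA (Set.toFinite _)
  have h2 := Set.ncard_sdiff_add_ncard_of_subset (Set.sdiff_subset.trans hA0 : A \ B ⊆ _)
    (Set.toFinite _)
  rw [← hgood, ncard_ne_zero, hcard] at h2
  rw [hA, hB] at h1
  rw [hn]
  zify at h1 h2
  push_cast
  linear_combination h2 - h1

theorem augmentPlane_selectedLine_eq_iff {Z₀ : Submodule K (traceZero K L)}
    (hZ₀ : IsNondegenerate Z₀) {ρ s ρ' s' : L} (hρ : ρ ≠ 0) (hρ' : ρ' ≠ 0)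
    (hs : s ∈ goodParameters K L) :
    augmentPlane (selectedLine Z₀ s') ρ' s' = augmentPlane (selectedLine Z₀ s) ρ s ↔
      ∃ c : K, c ≠ 0 ∧ ρ' = c • ρ ∧ s' = c • s := by
  constructor
  · intro h
    have h3 := finrank_augmentPlane hKL hρ (admissible_selectedLine hKL hZ₀ hs)
    -- Any line of the common plane suffices to recover the parameters up to Kˣ.
    obtain ⟨t, ht, hli⟩ := exists_finset_linearIndependent_of_le_finrank (h3.symm ▸
      (by norm_num : 2 ≤ 3) : 2 ≤ finrank K (augmentPlane (selectedLine Z₀ s) ρ s))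
    have hT := finrank_span_finset_eq_card hli
    rw [ht, ← Submodule.finrank_map_subtype_eq] at hT
    exact exists_smul_of_le_augmentPlane hKL hT hρ hρ' hs.1 (Submodule.map_subtype_le _ _)
      ((Submodule.map_subtype_le _ _).trans h.ge)
  · rintro ⟨c, hc, rfl, rfl⟩
    rw [selectedLine_smul _ _ hc, augmentPlane_smul _ _ _ hc]

theorem ncard_augmentation {Z₀ : Submodule K (traceZero K L)} (hZ₀ : IsNondegenerate Z₀) :
    ((augmentation Z₀).ncard : ℤ) = ((Fintype.card K : ℤ) ^ 4 - 1) *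
      ((Fintype.card K : ℤ) ^ 3 + Fintype.card K + 1) := by
  have := finite_of_finrank_eq_four hKL
  set f : L × L → Submodule K (Ambient K L) :=
    fun p => augmentPlane (selectedLine Z₀ p.2) p.1 p.2
  set A : Set (L × L) := {ρ | ρ ≠ 0} ×ˢ goodParameters K L
  have himg : augmentation Z₀ = f '' A := by
    ext E
    constructor
    · rintro ⟨ρ, s, hρ, hs, rfl⟩
      exact ⟨(ρ, s), ⟨hρ, hs⟩, rfl⟩
    · rintro ⟨⟨ρ, s⟩, ⟨hρ, hs⟩, rfl⟩
      exact ⟨ρ, s, hρ, hs, rfl⟩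
  have hfib : ∀ a ∈ A, {b ∈ A | f b = f a}.ncard = Fintype.card K - 1 := by
    rintro ⟨ρ, s⟩ ⟨hρ : ρ ≠ 0, hs : s ∈ goodParameters K L⟩
    have h1 : {b ∈ A | f b = f (ρ, s)} = (fun c : K => (c • ρ, c • s)) '' {c | c ≠ 0} := by
      ext ⟨ρ', s'⟩
      constructor
      · rintro ⟨⟨hρ', hs'⟩, h⟩
        obtain ⟨c, hc, rfl, rfl⟩ :=
          (augmentPlane_selectedLine_eq_iff hKL hZ₀ hρ hρ' hs).1 h
        exact ⟨c, hc, rfl⟩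
      · rintro ⟨c, hc : c ≠ 0, h⟩
        obtain ⟨rfl, rfl⟩ := Prod.ext_iff.1 h
        refine ⟨⟨smul_ne_zero hc hρ, smul_mem_goodParameters hs hc⟩, ?_⟩
        exact (augmentPlane_selectedLine_eq_iff hKL hZ₀ hρ (smul_ne_zero hc hρ) hs).2
          ⟨c, hc, rfl, rfl⟩
    rw [h1, Set.ncard_image_of_injective, ncard_ne_zero, Nat.card_eq_fintype_card]
    intro c d hcd
    exact smul_left_injective K hρ (Prod.ext_iff.1 hcd).1
  have h := ncard_eq_mul_ncard_image (Set.toFinite A) f hfib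
  rw [← himg, Set.ncard_prod, ncard_ne_zero, natCard_of_finrank_eq_four hKL] at h
  have hq : 1 < Fintype.card K := Fintype.one_lt_card
  have hg := ncard_goodParameters hKL
  zify [hq.le, Nat.one_le_pow 4 _ (zero_lt_one.trans hq)] at h
  rw [hg] at h
  have hq' : (Fintype.card K : ℤ) - 1 ≠ 0 := by
    have : (1 : ℤ) < Fintype.card K := by exact_mod_cast hq
    omega
  refine mul_left_cancel₀ hq' ?_
  linear_combination -h

/-- Passing through (0, p) means ρp ∈ Kˣ. Rescaling to ρ = p⁻¹ uses up the Kˣ-freedom, so the planes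
correspond to the good s. -/
theorem ncard_augmentation_of_point {Z₀ : Submodule K (traceZero K L)}
    (hZ₀ : IsNondegenerate Z₀) {P : Submodule K (Ambient K L)} (hP : finrank K P = 1)
    (hPS : P ≤ specialSolid K L) :
    (({E ∈ augmentation Z₀ | P ≤ E}).ncard : ℤ) = ((Fintype.card K : ℤ) - 1) *
      ((Fintype.card K : ℤ) ^ 3 + Fintype.card K + 1) := by
  obtain ⟨⟨x, p⟩, hv0, rfl⟩ := exists_eq_span_singleton_of_finrank_eq_one hP
  rw [Submodule.span_singleton_le_iff_mem] at hPS
  obtain rfl : x = 0 := hPS.1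
  have hp : p ≠ 0 := fun h => hv0 (by simp [h])
  simp only [Submodule.span_singleton_le_iff_mem]
  have himg : {E ∈ augmentation Z₀ | ((0, p) : Ambient K L) ∈ E} =
      (fun s => augmentPlane (selectedLine Z₀ s) p⁻¹ s) '' goodParameters K L := by
    ext E
    constructor
    · rintro ⟨⟨ρ, s, hρ, hs, rfl⟩, hPE⟩
      obtain ⟨c, hc⟩ := (mem_augmentPlane_of_fst_eq_zero hKL rfl).1 hPE
      replace hc : algebraMap K L c = ρ * p := hc
      have hc0 : c ≠ 0 := by
        rintro rfl
        rw [map_zero] at hc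
        exact mul_ne_zero hρ hp hc.symm
      refine ⟨c⁻¹ • s, smul_mem_goodParameters hs (inv_ne_zero hc0),
        (augmentPlane_selectedLine_eq_iff hKL hZ₀ hρ (inv_ne_zero hp) hs).2
          ⟨c⁻¹, inv_ne_zero hc0, ?_, rfl⟩⟩
      rw [Algebra.smul_def, map_inv₀, hc]
      field_simp
    · rintro ⟨s, hs, rfl⟩
      refine ⟨⟨_, s, inv_ne_zero hp, hs, rfl⟩, ?_⟩
      exact (mem_augmentPlane_of_fst_eq_zero hKL rfl).2 ⟨1, by simp [hp]⟩
  rw [himg, Set.InjOn.ncard_image, ncard_goodParameters hKL]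
  intro s hs s' hs' h
  obtain ⟨c, -, h1, rfl⟩ := (augmentPlane_selectedLine_eq_iff hKL hZ₀ (inv_ne_zero hp)
    (inv_ne_zero hp) hs').1 h
  have : c = 1 := smul_left_injective K (inv_ne_zero hp) (by simpa using h1.symm)
  simp [this]

theorem finite_liftedGabidulin : (liftedGabidulin K L).Finite := by
  have := finite_of_finrank_eq_four hKL
  refine (Set.finite_range fun p : L × L => (gabidulinMap K p.1 p.2).graph).subset ?_
  rintro _ ⟨a₀, a₁, rfl⟩
  exact ⟨(a₀, a₁), rfl⟩

theorem ncard_liftedGabidulin : (liftedGabidulin K L).ncard = Fintype.card K ^ 8 := by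
  have himg : liftedGabidulin K L =
      (fun p : L × L => (gabidulinMap K p.1 p.2).graph) '' Set.univ := by
    ext E
    constructor
    · rintro ⟨a₀, a₁, rfl⟩
      exact ⟨(a₀, a₁), trivial, rfl⟩
    · rintro ⟨⟨a₀, a₁⟩, -, rfl⟩
      exact ⟨a₀, a₁, rfl⟩
  rw [himg, Set.ncard_image_of_injective, Set.ncard_univ, Nat.card_prod,
    natCard_of_finrank_eq_four hKL]
  · ring
  · intro p p' h
    exact Prod.ext (graph_gabidulinMap_inj hKL h).1 (graph_gabidulinMap_inj hKL h).2

theorem ncard_trace_eq_one : {u : L | Algebra.trace K L u = 1}.ncard = Fintype.card K ^ 3 := by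
  have := finiteDimensional_of_finrank_eq_four hKL
  obtain ⟨u₀, hu₀⟩ := Algebra.trace_surjective K L 1
  have himg : {u : L | Algebra.trace K L u = 1} = (fun x => u₀ + x) '' (traceZero K L : Set L) := by
    ext u
    constructor
    · intro (hu : _ = _)
      exact ⟨u - u₀, by simp [hu, hu₀], by simp⟩
    · rintro ⟨x, hx, rfl⟩
      have : Algebra.trace K L x = 0 := hx
      simp [hu₀, this]
  rw [himg, Set.ncard_image_of_injective _ (add_right_injective u₀), ← Nat.card_coe_set_eq]
  exact natCard_traceZero hKL

theorem ncard_removedPlanes :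
    (removedPlanes K L).ncard = (Fintype.card K ^ 4 - 1) * Fintype.card K ^ 3 := by
  have := finite_of_finrank_eq_four hKL
  -- The pairs (r, u) and (cr, c⁻¹u) with c ∈ Kˣ give the same binomial; requiring Tr u = 1 selects
  -- one pair from each class.
  have himg : removedPlanes K L = (fun p : L × L => (binomialMap K p.1 p.2).graph) ''
      ({r | r ≠ 0} ×ˢ {u | Algebra.trace K L u = 1}) := by
    ext E
    constructor
    · rintro ⟨r, u, hr, hu, rfl⟩
      have ht : Algebra.trace K L u ≠ 0 := hu
      set t := Algebra.trace K L u with htdef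
      have ht' : algebraMap K L t ≠ 0 := by simpa using ht
      refine ⟨(t • r, t⁻¹ • u), ⟨smul_ne_zero ht hr, ?_⟩, ?_⟩
      · simp [← htdef, ht]
      · simp only [binomialMap, ← frob_apply (K := K), Algebra.smul_def, map_mul,
          AlgHom.commutes, map_inv₀]
        congr 2
        · field_simp
        · field_simp
    · rintro ⟨⟨r, u⟩, ⟨hr, hu : _ = _⟩, rfl⟩
      refine ⟨r, u, hr, fun h => ?_, rfl⟩
      rw [LinearMap.mem_ker, hu] at h
      exact one_ne_zero h
  rw [himg, Set.InjOn.ncard_image, Set.ncard_prod, ncard_ne_zero, natCard_of_finrank_eq_four hKL,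
    ncard_trace_eq_one hKL]
  rintro ⟨r, u⟩ ⟨hr : r ≠ 0, hu : _ = _⟩ ⟨r', u'⟩ ⟨hr' : r' ≠ 0, hu' : _ = _⟩ h
  obtain ⟨h1, h2⟩ := graph_gabidulinMap_inj hKL h
  simp only [← frob_apply (K := K), neg_inj] at h1 h2
  have hu0 : u ≠ 0 := by
    rintro rfl
    simp at hu
  obtain ⟨c, rfl⟩ := exists_smul_of_moore_eq_zero hKL hu0 (b := u') (by
    refine (mul_eq_zero.1 (?_ : r' * _ = 0)).resolve_left hr'
    rw [moore]
    linear_combination frob K L u * h2 - u * h1)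
  rw [map_smul, hu] at hu'
  obtain rfl : c = 1 := by simpa using hu'
  rw [one_smul] at h2 ⊢
  rw [mul_right_cancel₀ hu0 h2]

theorem ncard_expurgatedCode :
    ((expurgatedCode K L).ncard : ℤ) = (Fintype.card K : ℤ) ^ 8 - (Fintype.card K : ℤ) ^ 7 +
      (Fintype.card K : ℤ) ^ 3 := by
  have h := Set.ncard_sdiff_add_ncard_of_subset (removedPlanes_subset (K := K) (L := L))
    (finite_liftedGabidulin hKL)
  rw [ncard_liftedGabidulin hKL, ncard_removedPlanes hKL] at h
  zify [Nat.one_le_pow 4 _ (Fintype.card_pos (α := K))] at h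
  rw [expurgatedCode]
  linear_combination h

end Counting

end PlaneCode

theorem mainTheorem1 (K L : Type*) [Field K] [Fintype K] [Field L] [Algebra K L]
    (hKL : Module.finrank K L = 4) (q : ℕ) (hq : Fintype.card K = q) :
    PlaneCode.IsPlaneSubspaceCode 2 (PlaneCode.expurgatedCode K L) ∧
    ((PlaneCode.expurgatedCode K L).ncard : ℤ) = (q : ℤ) ^ 8 - (q : ℤ) ^ 7 + (q : ℤ) ^ 3 ∧
    ∃ N : Set (Submodule K (PlaneCode.Ambient K L)),
      Disjoint (PlaneCode.liftedGabidulin K L) N ∧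
      (∀ E ∈ N, Module.finrank K E = 3 ∧
        Module.finrank K (E ⊓ PlaneCode.specialSolid K L : Submodule K _) = 1) ∧
      (N.ncard : ℤ) = ((q : ℤ) ^ 4 - 1) * ((q : ℤ) ^ 3 + q + 1) ∧
      (∀ P : Submodule K (PlaneCode.Ambient K L),
        Module.finrank K P = 1 → P ≤ PlaneCode.specialSolid K L →
          (({E ∈ N | P ≤ E}).ncard : ℤ) = ((q : ℤ) - 1) * ((q : ℤ) ^ 3 + q + 1)) ∧
      PlaneCode.IsPlaneSubspaceCode 2 (PlaneCode.expurgatedCode K L ∪ N) ∧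
      ((PlaneCode.expurgatedCode K L ∪ N).ncard : ℤ) =
        (q : ℤ) ^ 8 + (q : ℤ) ^ 5 + (q : ℤ) ^ 4 - q - 1 ∧
      PlaneCode.IsSigmaInvariant K (PlaneCode.expurgatedCode K L ∪ N) := by
  subst hq
  obtain ⟨Z₀, hZ₀⟩ := PlaneCode.exists_isNondegenerate hKL
  have hdisj := PlaneCode.disjoint_liftedGabidulin_augmentation hKL Z₀
  have hN := PlaneCode.ncard_augmentation hKL hZ₀
  refine ⟨PlaneCode.isPlaneSubspaceCode_of_subset hKL hZ₀ subset_rfl Set.subset_union_left,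
    PlaneCode.ncard_expurgatedCode hKL, PlaneCode.augmentation Z₀, hdisj, ?_, hN,
    fun P => PlaneCode.ncard_augmentation_of_point hKL hZ₀,
    PlaneCode.isPlaneSubspaceCode_of_subset hKL hZ₀ Set.subset_union_left subset_rfl, ?_,
    PlaneCode.isSigmaInvariant_expurgatedCode_union Z₀⟩
  · rintro _ ⟨ρ, s, hρ, hs, rfl⟩
    exact ⟨PlaneCode.finrank_augmentPlane hKL hρ (PlaneCode.admissible_selectedLine hKL hZ₀ hs),
      PlaneCode.finrank_augmentPlane_inf_specialSolid hKL hρ⟩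
  · have hfin : (PlaneCode.augmentation Z₀).Finite := by
      have := PlaneCode.finite_of_finrank_eq_four hKL
      refine (Set.finite_range fun p : L × L => PlaneCode.augmentPlane
        (PlaneCode.selectedLine Z₀ p.2) p.1 p.2).subset ?_
      rintro _ ⟨ρ, s, -, -, rfl⟩
      exact ⟨(ρ, s), rfl⟩
    rw [Set.ncard_union_eq (s := PlaneCode.expurgatedCode K L)
      (hdisj.mono_left Set.sdiff_subset)
      ((PlaneCode.finite_liftedGabidulin hKL).subset Set.sdiff_subset) hfin, Nat.cast_add, hN,
      PlaneCode.ncard_expurgatedCode hKL]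
    ring
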